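/- For a real number $\lambda>0$ let $G_\lambda$ be the subgroup of $SL_2(\mathbb{R})$ generated by the matrices $\begin{pmatrix}1&\lambda\\0&1\end{pmatrix}$ and $\begin{pmatrix}0&1\\-1&0\end{pmatrix}$. Then $G_\lambda$ is a discrete subgroup of $SL_2(\mathbb{R})$ (for its usual topology, as a subspace of the real $2\times 2$ matrices) if and only if $$\lambda\in[2,\infty)\ \cup\ \Bigl\{\,2\cos\Bigl(\frac{\pi}{n}\Bigr)\ :\ n\in\mathbb{Z},\ n\ge 3\Bigr\}.$$ -/

import Mathlib

open scoped MatrixGroups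

/-- The upper unitriangular matrix with entries `1, l, 0, 1` in `SL₂(ℝ)`. -/
def heckeT (l : ℝ) : SL(2, ℝ) :=
  ⟨!![1, l; 0, 1], by simp [Matrix.det_fin_two_of]⟩

/-- The matrix with entries `0, 1, -1, 0` in `SL₂(ℝ)`. -/
def heckeS : SL(2, ℝ) :=
  ⟨!![0, 1; -1, 0], by simp [Matrix.det_fin_two_of]⟩

/-- The Hecke group `G_l`: the subgroup of `SL₂(ℝ)` generated by `heckeT l` and `heckeS`. -/
def heckeGroup (l : ℝ) : Subgroup SL(2, ℝ) :=
  Subgroup.closure {heckeT l, heckeS}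

/-! Put U = TS⁻¹, so G is generated by U and S. The entries of Uᵏ are Chebyshev values sₖ:
sin(kθ)/sin θ if l = 2cos θ, and strictly increasing in k ≥ 0 if l ≥ 2.

Sufficiency: up to sign and a final S, each element of G is ±1 or ±S times a product of blocks UᵏS
with sₖ ≠ 0 (`IsHeckeWordS.of_mem`). For the listed l, the entries of a block share a sign and are 0
or at least 1 in absolute value (`HasGaps`). Products keep this row by row, so entries of G avoid a
punctured neighbourhood of 0 and G is discrete.

Necessity: let l = 2cos θ < 2. Unless π/θ is an integer, some kθ + mπ lies in (0, θ/2]; then the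
lower left entry of Uᵏ is nonzero but too small for Shimizu's lemma. -/

open Filter Topology

/-! ### Generators and powers of U. -/

/-- The product of `heckeT l` with the inverse of `heckeS`. -/
def heckeU (l : ℝ) : SL(2, ℝ) :=
  ⟨!![l, -1; 1, 0], by simp [Matrix.det_fin_two_of]⟩

theorem coe_heckeT (l : ℝ) : (heckeT l : Matrix (Fin 2) (Fin 2) ℝ) = !![1, l; 0, 1] := rfl

theorem coe_heckeS : (heckeS : Matrix (Fin 2) (Fin 2) ℝ) = !![0, 1; -1, 0] := rfl

theorem coe_heckeU (l : ℝ) : (heckeU l : Matrix (Fin 2) (Fin 2) ℝ) = !![l, -1; 1, 0] := rfl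

theorem heckeU_mul_heckeS (l : ℝ) : heckeU l * heckeS = heckeT l := by
  ext i j
  fin_cases i <;> fin_cases j <;> simp [coe_heckeU, coe_heckeS, coe_heckeT, Matrix.mul_apply, Fin.sum_univ_two]

theorem heckeS_mul_heckeS : heckeS * heckeS = -1 := by
  ext i j
  fin_cases i <;> fin_cases j <;> simp [coe_heckeS, Matrix.mul_apply, Fin.sum_univ_two]

theorem heckeS_inv : heckeS⁻¹ = -heckeS := by
  rw [inv_eq_iff_mul_eq_one, mul_neg, heckeS_mul_heckeS, neg_neg]

theorem heckeT_mem (l : ℝ) : heckeT l ∈ heckeGroup l :=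
  Subgroup.subset_closure (by simp)

theorem heckeS_mem (l : ℝ) : heckeS ∈ heckeGroup l :=
  Subgroup.subset_closure (by simp)

theorem heckeU_mem (l : ℝ) : heckeU l ∈ heckeGroup l := by
  rw [← Subgroup.mul_mem_cancel_right _ (heckeS_mem l), heckeU_mul_heckeS]
  exact heckeT_mem l

/-- The two-sided solution of the Chebyshev recurrence with values `0, 1` at `0, 1`. -/
structure IsChebyshevSeq (l : ℝ) (s : ℤ → ℝ) : Prop where
  zero : s 0 = 0
  one : s 1 = 1
  add_one : ∀ k, s (k + 1) = l * s k - s (k - 1)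

theorem IsChebyshevSeq.coe_heckeU_zpow {l : ℝ} {s : ℤ → ℝ} (hs : IsChebyshevSeq l s) (k : ℤ) :
    ((heckeU l ^ k : SL(2, ℝ)) : Matrix (Fin 2) (Fin 2) ℝ) =
      !![s (k + 1), -s k; s k, -s (k - 1)] := by
  induction k using Int.induction_on with
  | zero =>
    have h := hs.add_one 0
    rw [hs.zero, zero_add, hs.one] at h
    have h' : s (-1) = -1 := by rw [zero_sub] at h; linarith
    ext i j
    fin_cases i <;> fin_cases j <;> simp [hs.zero, hs.one, h']
  | succ k ih =>
    have h := hs.add_one k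
    have h' := hs.add_one (k + 1)
    rw [add_sub_cancel_right] at h'
    rw [zpow_add_one, Matrix.SpecialLinearGroup.coe_mul, ih, add_sub_cancel_right]
    ext i j
    fin_cases i <;> fin_cases j <;>
      simp [coe_heckeU, Matrix.mul_apply, Fin.sum_univ_two] <;> linarith
  | pred k ih =>
    have h := hs.add_one (-k)
    have h' := hs.add_one (-k - 1)
    rw [sub_add_cancel] at h'
    rw [zpow_sub_one, Matrix.SpecialLinearGroup.coe_mul, ih, sub_add_cancel,
      Matrix.SpecialLinearGroup.coe_inv]
    ext i j
    fin_cases i <;> fin_cases j <;>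
      simp [coe_heckeU, Matrix.mul_apply, Fin.sum_univ_two, Matrix.adjugate_fin_two_of] <;> linarith

/-- The recurrence makes the diagonal entries equal, so Uᵏ is scalar of determinant 1. Such powers
drop out of words. -/
theorem IsChebyshevSeq.heckeU_zpow_eq_one_or {l : ℝ} {s : ℤ → ℝ} (hs : IsChebyshevSeq l s) {k : ℤ}
    (hk : s k = 0) : heckeU l ^ k = 1 ∨ heckeU l ^ k = -1 := by
  have hU := hs.coe_heckeU_zpow k
  have hdet := (heckeU l ^ k).det_coe
  have h := hs.add_one k
  rw [hk] at h
  have h' : -s (k - 1) = s (k + 1) := by linarith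
  rw [hU, Matrix.det_fin_two_of, hk, h'] at hdet
  rw [hk, h'] at hU
  have : s (k + 1) = 1 ∨ s (k + 1) = -1 := mul_self_eq_one_iff.1 (by linarith)
  rcases this with h1 | h1
  · left
    ext i j
    rw [hU, h1]
    fin_cases i <;> fin_cases j <;> simp
  · right
    ext i j
    rw [hU, h1]
    fin_cases i <;> fin_cases j <;> simp

/-! ### Sign-coherent vectors with a gap at zero. -/

/-- Being zero or at least one. -/
def IsZeroOrGeOne (x : ℝ) : Prop := x = 0 ∨ 1 ≤ x

theorem IsZeroOrGeOne.nonneg {x : ℝ} (hx : IsZeroOrGeOne x) : 0 ≤ x := by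
  rcases hx with h | h <;> linarith

theorem IsZeroOrGeOne.add {x y : ℝ} (hx : IsZeroOrGeOne x) (hy : IsZeroOrGeOne y) :
    IsZeroOrGeOne (x + y) := by
  have := hx.nonneg
  have := hy.nonneg
  rcases hx with h | h
  · simpa [h] using hy
  · right; linarith

theorem IsZeroOrGeOne.mul {x y : ℝ} (hx : IsZeroOrGeOne x) (hy : IsZeroOrGeOne y) :
    IsZeroOrGeOne (x * y) := by
  rcases hx with h | h
  · left; simp [h]
  rcases hy with h' | h'
  · left; simp [h']
  right; exact one_le_mul_of_one_le_of_one_le h h'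

/-- A finite family of reals which, up to a common sign, are zero or at least one. -/
def SameSign {ι : Type*} (v : ι → ℝ) : Prop :=
  (∀ i, IsZeroOrGeOne (v i)) ∨ ∀ i, IsZeroOrGeOne (-v i)

theorem SameSign.neg {ι : Type*} {v : ι → ℝ} (hv : SameSign v) : SameSign fun i => -v i := by
  rcases hv with h | h
  · right; simpa using h
  · left; exact h

theorem SameSign.eq_zero_or_one_le_abs {ι : Type*} {v : ι → ℝ} (hv : SameSign v) (i : ι) :
    v i = 0 ∨ 1 ≤ |v i| := by
  rcases hv with h | h <;> rcases h i with h | h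
  · exact Or.inl h
  · exact Or.inr (h.trans (le_abs_self _))
  · exact Or.inl (neg_eq_zero.1 h)
  · exact Or.inr (h.trans (neg_le_abs _))

theorem SameSign.mul_add_mul {v : Fin 2 → ℝ} {w : Fin 2 × Fin 2 → ℝ} (hv : SameSign v)
    (hw : SameSign w) : SameSign fun j => v 0 * w (0, j) + v 1 * w (1, j) := by
  rcases hv with hv | hv <;> rcases hw with hw | hw
  · exact Or.inl fun j => ((hv 0).mul (hw _)).add ((hv 1).mul (hw _))
  · refine Or.inr fun j => ?_
    have := ((hv 0).mul (hw (0, j))).add ((hv 1).mul (hw (1, j)))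
    convert this using 1; ring
  · refine Or.inr fun j => ?_
    have := ((hv 0).mul (hw (0, j))).add ((hv 1).mul (hw (1, j)))
    convert this using 1; ring
  · refine Or.inl fun j => ?_
    have := ((hv 0).mul (hw (0, j))).add ((hv 1).mul (hw (1, j)))
    convert this using 1; ring

/-! ### Normal form for elements of the group. -/

/-- Products of `±1` or `±heckeS` with matrices `heckeU l ^ k * heckeS` for `s k ≠ 0`. -/
inductive IsHeckeWord (l : ℝ) (s : ℤ → ℝ) : SL(2, ℝ) → Prop
  | one : IsHeckeWord l s 1
  | neg_one : IsHeckeWord l s (-1)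
  | heckeS : IsHeckeWord l s heckeS
  | neg_heckeS : IsHeckeWord l s (-heckeS)
  | mul (g : SL(2, ℝ)) (k : ℤ) (hg : IsHeckeWord l s g) (hk : s k ≠ 0) :
      IsHeckeWord l s (g * (heckeU l ^ k * _root_.heckeS))

theorem IsHeckeWord.neg {l : ℝ} {s : ℤ → ℝ} {g : SL(2, ℝ)} (hg : IsHeckeWord l s g) :
    IsHeckeWord l s (-g) := by
  induction hg with
  | one => exact .neg_one
  | neg_one => rw [neg_neg]; exact .one
  | heckeS => exact .neg_heckeS
  | neg_heckeS => rw [neg_neg]; exact .heckeS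
  | mul g k _ hk ih => rw [← neg_mul]; exact .mul _ _ ih hk

/-- A word, possibly followed by `heckeS` (up to sign). -/
def IsHeckeWordS (l : ℝ) (s : ℤ → ℝ) (g : SL(2, ℝ)) : Prop :=
  IsHeckeWord l s g ∨ IsHeckeWord l s (g * heckeS)

theorem IsHeckeWordS.mul_heckeS {l : ℝ} {s : ℤ → ℝ} {g : SL(2, ℝ)} (hg : IsHeckeWordS l s g) :
    IsHeckeWordS l s (g * heckeS) := by
  rcases hg with h | h
  · right
    rw [mul_assoc, heckeS_mul_heckeS, mul_neg, mul_one]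
    exact h.neg
  · exact Or.inl h

theorem IsHeckeWordS.neg {l : ℝ} {s : ℤ → ℝ} {g : SL(2, ℝ)} (hg : IsHeckeWordS l s g) :
    IsHeckeWordS l s (-g) := by
  rcases hg with h | h
  · exact Or.inl h.neg
  · right; rw [neg_mul]; exact h.neg

theorem IsHeckeWordS.mul_heckeS_inv {l : ℝ} {s : ℤ → ℝ} {g : SL(2, ℝ)}
    (hg : IsHeckeWordS l s g) : IsHeckeWordS l s (g * heckeS⁻¹) := by
  rw [heckeS_inv, mul_neg]
  exact hg.mul_heckeS.neg

/-- If g ends in a bare power Uᵏ, the exponents merge to k + j; when s (k + j) = 0 the merged power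
is ±1 and the block disappears. -/
theorem IsHeckeWordS.mul_heckeU_zpow {l : ℝ} {s : ℤ → ℝ} (hs : IsChebyshevSeq l s)
    {g : SL(2, ℝ)} (hg : IsHeckeWordS l s g) {j : ℤ} (hj : s j ≠ 0) :
    IsHeckeWordS l s (g * heckeU l ^ j) := by
  have key : ∀ h, IsHeckeWord l s h → IsHeckeWordS l s (h * heckeU l ^ j) := fun h hh => by
    right; rw [mul_assoc]; exact .mul _ _ hh hj
  rcases hg with h | h
  · exact key g h
  · have hS : ∀ x, g * heckeS = x → g = -(x * heckeS) := by
      rintro x rfl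
      rw [mul_assoc, heckeS_mul_heckeS, mul_neg, mul_one, neg_neg]
    generalize hx : g * heckeS = x at h
    have hgx := hS x hx
    cases h with
    | one => subst hgx; refine key _ ?_; rw [one_mul]; exact .neg_heckeS
    | neg_one => subst hgx; refine key _ ?_; rw [neg_mul, one_mul, neg_neg]; exact .heckeS
    | heckeS => subst hgx; refine key _ ?_; rw [heckeS_mul_heckeS, neg_neg]; exact .one
    | neg_heckeS =>
      subst hgx; refine key _ ?_; rw [neg_mul, heckeS_mul_heckeS, neg_neg]; exact .neg_one
    | mul N k hN hk =>
      have hgN : g = N * heckeU l ^ k := by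
        rw [hgx, mul_assoc, mul_assoc, heckeS_mul_heckeS, mul_neg, mul_neg, neg_neg, mul_one]
      rw [hgN, mul_assoc, ← zpow_add]
      by_cases h0 : s (k + j) = 0
      · left
        rcases hs.heckeU_zpow_eq_one_or h0 with h | h
        · rwa [h, mul_one]
        · rw [h, mul_neg, mul_one]; exact hN.neg
      · right; rw [mul_assoc]; exact .mul _ _ hN h0

theorem IsHeckeWordS.of_mem {l : ℝ} {s : ℤ → ℝ} (hs : IsChebyshevSeq l s) {g : SL(2, ℝ)}
    (hg : g ∈ heckeGroup l) : IsHeckeWordS l s g := by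
  have h1 : s 1 ≠ 0 := by rw [hs.one]; exact one_ne_zero
  have h2 : s (-1) ≠ 0 := by
    have h := hs.add_one 0
    rw [hs.zero, zero_add, hs.one, zero_sub] at h
    intro h'
    rw [h'] at h
    norm_num at h
  induction hg using Subgroup.closure_induction_right with
  | one => exact Or.inl .one
  | mul_right x _ y hy ih =>
    rcases hy with rfl | rfl
    · rw [← heckeU_mul_heckeS, ← mul_assoc]
      have := ih.mul_heckeU_zpow hs h1
      rw [zpow_one] at this
      exact this.mul_heckeS
    · exact ih.mul_heckeS
  | mul_inv_cancel x _ y hy ih =>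
    rcases hy with rfl | rfl
    · rw [← heckeU_mul_heckeS, mul_inv_rev, ← mul_assoc]
      have := ih.mul_heckeS_inv.mul_heckeU_zpow hs h2
      rwa [zpow_neg_one] at this
    · exact ih.mul_heckeS_inv

/-! ### From gaps in the sequence to discreteness. -/

/-- Three consecutive terms around a nonzero one have the same sign and are zero or at least one
in absolute value. -/
def HasGaps (s : ℤ → ℝ) : Prop :=
  ∀ k, s k ≠ 0 → SameSign ![s (k - 1), s k, s (k + 1)]

theorem IsHeckeWord.sameSign {l : ℝ} {s : ℤ → ℝ} (hs : IsChebyshevSeq l s) (hgap : HasGaps s)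
    {g : SL(2, ℝ)} (hg : IsHeckeWord l s g) (i : Fin 2) : SameSign fun j => g i j := by
  induction hg generalizing i with
  | one =>
    left; intro j
    fin_cases i <;> fin_cases j <;> simp [IsZeroOrGeOne]
  | neg_one =>
    right; intro j
    fin_cases i <;> fin_cases j <;> simp [IsZeroOrGeOne]
  | heckeS =>
    fin_cases i
    · left; intro j
      fin_cases j <;> simp [IsZeroOrGeOne, coe_heckeS]
    · right; intro j
      fin_cases j <;> simp [IsZeroOrGeOne, coe_heckeS]
  | neg_heckeS =>
    fin_cases i
    · right; intro j
      fin_cases j <;> simp [IsZeroOrGeOne, coe_heckeS]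
    · left; intro j
      fin_cases j <;> simp [IsZeroOrGeOne, coe_heckeS]
  | mul N k _ hk ih =>
    -- UᵏS has rows (sₖ, sₖ₊₁) and (sₖ₋₁, sₖ).
    have hV : ∀ p : Fin 2 × Fin 2, (heckeU l ^ k * _root_.heckeS) p.1 p.2 =
        ![s (k - 1), s k, s (k + 1)] (![![1, 2], ![0, 1]] p.1 p.2) := by
      rintro ⟨a, b⟩
      rw [Matrix.SpecialLinearGroup.coe_mul, hs.coe_heckeU_zpow]
      fin_cases a <;> fin_cases b <;>
        simp [coe_heckeS, Matrix.mul_apply, Fin.sum_univ_two]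
    have hw : SameSign fun p : Fin 2 × Fin 2 => (heckeU l ^ k * _root_.heckeS) p.1 p.2 := by
      simp only [hV]
      rcases hgap k hk with h | h
      · exact Or.inl fun p => h _
      · exact Or.inr fun p => h _
    have := (ih i).mul_add_mul hw
    convert this using 2 with j
    rw [Matrix.SpecialLinearGroup.coe_mul, Matrix.mul_apply, Fin.sum_univ_two]

theorem heckeGroup_entry_eq_zero_or {l : ℝ} {s : ℤ → ℝ} (hs : IsChebyshevSeq l s)
    (hgap : HasGaps s) {g : SL(2, ℝ)} (hg : g ∈ heckeGroup l) (i j : Fin 2) :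
    g i j = 0 ∨ 1 ≤ |g i j| := by
  rcases IsHeckeWordS.of_mem hs hg with h | h
  · exact (h.sameSign hs hgap i).eq_zero_or_one_le_abs j
  -- Right multiplication by S only swaps the columns up to sign.
  · have h' := h.sameSign hs hgap i
    have e0 : (g * heckeS) i 0 = -g i 1 := by
      simp [coe_heckeS, Matrix.mul_apply, Fin.sum_univ_two]
    have e1 : (g * heckeS) i 1 = g i 0 := by
      simp [coe_heckeS, Matrix.mul_apply, Fin.sum_univ_two]
    fin_cases j
    · have := h'.eq_zero_or_one_le_abs 1
      rwa [e1] at this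
    · have := h'.eq_zero_or_one_le_abs 0
      rwa [e0, neg_eq_zero, abs_neg] at this

theorem continuous_entry (i j : Fin 2) : Continuous fun g : SL(2, ℝ) => g i j :=
  Matrix.SpecialLinearGroup.isClosedEmbedding_val.continuous.matrix_elem i j

/-- A subgroup whose matrix entries avoid a punctured neighbourhood of zero is discrete. -/
theorem discreteTopology_of_entries {G : Subgroup SL(2, ℝ)}
    (hG : ∀ g ∈ G, ∀ i j, g i j = 0 ∨ 1 ≤ |g i j|) : DiscreteTopology G := by
  apply discreteTopology_of_isOpen_singleton_one
  -- Here the off-diagonal entries must vanish; then ad = 1 with a, d ≥ 1 leaves only the identity.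
  have : ({1} : Set G) = {g : G | |(g : SL(2, ℝ)) 0 1| < 1} ∩ {g : G | |(g : SL(2, ℝ)) 1 0| < 1} ∩
      {g : G | 0 < (g : SL(2, ℝ)) 0 0} := by
    ext ⟨g, hg⟩
    simp only [Set.mem_singleton_iff, Set.mem_inter_iff, Set.mem_ofPred_eq, Subgroup.mk_eq_one]
    constructor
    · rintro rfl; simp
    · rintro ⟨⟨hb, hc⟩, ha⟩
      have hb' : g 0 1 = 0 := (hG g hg 0 1).resolve_right (not_le.2 hb)
      have hc' : g 1 0 = 0 := (hG g hg 1 0).resolve_right (not_le.2 hc)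
      have hdet := g.det_coe
      rw [Matrix.det_fin_two, hb', hc', zero_mul, sub_zero] at hdet
      have hd : 0 < g 1 1 := by
        by_contra! h
        nlinarith
      have ha1 := (hG g hg 0 0).resolve_left ha.ne'
      have hd1 := (hG g hg 1 1).resolve_left hd.ne'
      rw [abs_of_pos ha] at ha1
      rw [abs_of_pos hd] at hd1
      have ea : g 0 0 = 1 := by nlinarith
      have ed : g 1 1 = 1 := by rwa [ea, one_mul] at hdet
      ext i j
      fin_cases i <;> fin_cases j <;> simp [ea, ed, hb', hc']
  rw [this]
  have hc : ∀ i j, Continuous fun g : G => (g : SL(2, ℝ)) i j := fun i j =>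
    (continuous_entry i j).comp continuous_subtype_val
  exact ((isOpen_lt (hc 0 1).abs continuous_const).inter
    (isOpen_lt (hc 1 0).abs continuous_const)).inter (isOpen_lt continuous_const (hc 0 0))

/-! ### The gap property for both kinds of l. -/

theorem isChebyshevSeq_sin {θ : ℝ} (hθ : Real.sin θ ≠ 0) :
    IsChebyshevSeq (2 * Real.cos θ) fun k => Real.sin (k * θ) / Real.sin θ where
  zero := by simp
  one := by simp [hθ]
  add_one k := by
    push_cast
    rw [add_mul, sub_mul, one_mul, Real.sin_add, Real.sin_sub]
    field_simp
    ring

/-- On [π/n, π − π/n] the sine is at least sin(π/n). Shifting k by n only changes the sign, and a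
nonzero term has residue r in [1, n − 1], so r ± 1 stay in [0, n]. -/
theorem hasGaps_sin {n : ℕ} (hn : 2 ≤ n) :
    HasGaps fun k => Real.sin (k * (Real.pi / n)) / Real.sin (Real.pi / n) := by
  have hn0 : (0 : ℝ) < n := by positivity
  have hn2 : (2 : ℝ) ≤ n := by exact_mod_cast hn
  have hpos : 0 < Real.sin (Real.pi / n) :=
    Real.sin_pos_of_pos_of_lt_pi (by positivity)
      (div_lt_self Real.pi_pos (by linarith))
  have hle : Real.pi / n ≤ Real.pi / 2 := div_le_div_of_nonneg_left Real.pi_pos.le two_pos hn2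
  have hnp : n * (Real.pi / n) = Real.pi := by field_simp
  have base : ∀ r : ℤ, 0 ≤ r → r ≤ n →
      IsZeroOrGeOne (Real.sin (r * (Real.pi / n)) / Real.sin (Real.pi / n)) := by
    intro r h0 h1
    rcases h0.eq_or_lt with rfl | h0
    · left; simp
    rcases h1.eq_or_lt with rfl | h1
    · left; simp [hnp]
    right
    rw [le_div_iff₀ hpos, one_mul]
    have hr : (1 : ℝ) ≤ r := by exact_mod_cast h0
    have hr' : (r : ℝ) ≤ n - 1 := by
      have : r ≤ n - 1 := by omega
      exact_mod_cast this
    have hp : 0 < Real.pi / n := by positivity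
    have u1 : Real.pi / n ≤ r * (Real.pi / n) := le_mul_of_one_le_left hp.le hr
    have u2 : r * (Real.pi / n) ≤ Real.pi - Real.pi / n := by nlinarith
    rcases le_total (r * (Real.pi / n)) (Real.pi / 2) with h | h
    · exact Real.sin_le_sin_of_le_of_le_pi_div_two (by linarith) h u1
    · rw [← Real.sin_pi_sub (r * (Real.pi / n))]
      exact Real.sin_le_sin_of_le_of_le_pi_div_two (by linarith) (by linarith) (by linarith)
  intro k hk
  obtain ⟨q, r, hr0, hrn, rfl⟩ : ∃ q r : ℤ, 0 ≤ r ∧ r < n ∧ k = q * n + r :=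
    ⟨k / n, k % n, Int.emod_nonneg _ (by omega), Int.emod_lt_of_pos _ (by omega),
      by rw [mul_comm]; exact (Int.mul_ediv_add_emod k n).symm⟩
  have shift : ∀ j : ℤ, Real.sin (((q * n + j : ℤ) : ℝ) * (Real.pi / n)) / Real.sin (Real.pi / n) =
      (-1) ^ q * (Real.sin (j * (Real.pi / n)) / Real.sin (Real.pi / n)) := by
    intro j
    have : ((q * n + j : ℤ) : ℝ) * (Real.pi / n) = j * (Real.pi / n) + q * Real.pi := by
      push_cast
      rw [add_mul, mul_assoc, hnp, add_comm]
    rw [this, Real.sin_add_int_mul_pi, mul_div_assoc]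
  have hr1 : 1 ≤ r := by
    by_contra! h
    obtain rfl : r = 0 := by omega
    apply hk
    simp only [shift]
    simp
  have e1 : q * (n : ℤ) + r - 1 = q * n + (r - 1) := by ring
  have e2 : q * (n : ℤ) + r + 1 = q * n + (r + 1) := by ring
  simp only [e1, e2, shift]
  have b1 := base (r - 1) (by omega) (by omega)
  have b2 := base r (by omega) (by omega)
  have b3 := base (r + 1) (by omega) (by omega)
  rcases Int.even_or_odd q with h | h
  · left
    rw [h.neg_one_zpow]
    intro i
    fin_cases i
    · simpa using b1
    · simpa using b2
    · simpa using b3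
  · right
    rw [h.neg_one_zpow]
    intro i
    fin_cases i
    · simpa using b1
    · simpa using b2
    · simpa using b3

theorem isChebyshevSeq_S (l : ℝ) :
    IsChebyshevSeq l fun k => (Polynomial.Chebyshev.S ℝ (k - 1)).eval l where
  zero := by simp
  one := by simp
  add_one k := by
    have := Polynomial.Chebyshev.S_add_one ℝ (k - 1)
    rw [sub_add_cancel] at this
    rw [add_sub_cancel_right, this]
    simp

theorem IsChebyshevSeq.neg {l : ℝ} {s : ℤ → ℝ} (hs : IsChebyshevSeq l s) (k : ℤ) :
    s (-k) = -s k := by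
  have h := congrFun₂ (hs.coe_heckeU_zpow (-k)) 1 0
  have h' := hs.coe_heckeU_zpow k
  rw [zpow_neg, Matrix.SpecialLinearGroup.coe_inv, h', Matrix.adjugate_fin_two_of] at h
  simpa using h.symm

/-- As l ≥ 2, the increments do not decrease for k ≥ 0, and the first is 1; oddness covers negative
k. -/
theorem IsChebyshevSeq.hasGaps {l : ℝ} {s : ℤ → ℝ} (hs : IsChebyshevSeq l s) (hl : 2 ≤ l) :
    HasGaps s := by
  have mono : ∀ k : ℕ, 0 ≤ s k ∧ s k + 1 ≤ s (k + 1) := by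
    intro k
    induction k with
    | zero => simp [hs.zero, hs.one]
    | succ k ih =>
      have h := hs.add_one (k + 1)
      rw [add_sub_cancel_right] at h
      push_cast
      refine ⟨by linarith, ?_⟩
      nlinarith
  have base : ∀ k : ℤ, 0 ≤ k → IsZeroOrGeOne (s k) := by
    intro k hk
    lift k to ℕ using hk
    rcases k with _ | k
    · left; simpa using hs.zero
    · right
      have := mono k
      push_cast
      linarith
  intro k hk
  rcases lt_trichotomy k 0 with h | rfl | h
  · right
    intro i
    have b1 := base (-(k - 1)) (by omega)
    have b2 := base (-k) (by omega)
    have b3 := base (-(k + 1)) (by omega)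
    rw [hs.neg] at b1 b2 b3
    fin_cases i
    · exact b1
    · exact b2
    · exact b3
  · exact absurd hs.zero hk
  · left
    intro i
    fin_cases i
    · exact base (k - 1) (by omega)
    · exact base k (by omega)
    · exact base (k + 1) (by omega)

/-! ### Shimizu's lemma. -/

/-- The conjugation step `A ↦ A T A⁻¹` of Shimizu's lemma, iterated. -/
def shimizuSeq (l : ℝ) (A : SL(2, ℝ)) : ℕ → SL(2, ℝ)
  | 0 => A
  | n + 1 => shimizuSeq l A n * heckeT l * (shimizuSeq l A n)⁻¹

theorem coe_conj_heckeT (l : ℝ) (A : SL(2, ℝ)) :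
    ((A * heckeT l * A⁻¹ : SL(2, ℝ)) : Matrix (Fin 2) (Fin 2) ℝ) =
      !![1 - l * (A 0 0 * A 1 0), l * A 0 0 ^ 2; -(l * A 1 0 ^ 2), 1 + l * (A 0 0 * A 1 0)] := by
  have hdet := A.det_coe
  rw [Matrix.det_fin_two] at hdet
  rw [Matrix.SpecialLinearGroup.coe_mul, Matrix.SpecialLinearGroup.coe_mul,
    Matrix.SpecialLinearGroup.coe_inv, Matrix.adjugate_fin_two]
  ext i j
  fin_cases i <;> fin_cases j <;>
    simp [coe_heckeT, Matrix.mul_apply, Fin.sum_univ_two] <;>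
    first | ring1 | linear_combination hdet

/-- **Shimizu's lemma**: in a discrete group containing a translation by `l`, a lower left entry
`c` with `|l * c| < 1` vanishes. -/
theorem lower_left_eq_zero_of_discreteTopology {l : ℝ} (hl : l ≠ 0) {G : Subgroup SL(2, ℝ)}
    [DiscreteTopology G] (hT : heckeT l ∈ G) {A : SL(2, ℝ)} (hA : A ∈ G)
    (hlt : |l * A 1 0| < 1) : A 1 0 = 0 := by
  by_contra hc0
  set r := |l * A 1 0| with hr
  have hr0 : 0 ≤ r := abs_nonneg _
  let B := shimizuSeq l A
  have hB : ∀ n, ((B (n + 1) : SL(2, ℝ)) : Matrix (Fin 2) (Fin 2) ℝ) = _ := fun n =>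
    coe_conj_heckeT l (B n)
  have h00 : ∀ n, B (n + 1) 0 0 = 1 - l * (B n 0 0 * B n 1 0) := fun n => by rw [hB]; rfl
  have h01 : ∀ n, B (n + 1) 0 1 = l * B n 0 0 ^ 2 := fun n => by rw [hB]; rfl
  have h10 : ∀ n, B (n + 1) 1 0 = -(l * B n 1 0 ^ 2) := fun n => by rw [hB]; rfl
  have h11 : ∀ n, B (n + 1) 1 1 = 1 + l * (B n 0 0 * B n 1 0) := fun n => by rw [hB]; rfl
  have hmem : ∀ n, B n ∈ G := by
    intro n
    induction n with
    | zero => exact hA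
    | succ n ih => exact G.mul_mem (G.mul_mem ih hT) (G.inv_mem ih)
  have hne : ∀ n, B n 1 0 ≠ 0 := by
    intro n
    induction n with
    | zero => exact hc0
    | succ n ih =>
      rw [h10]
      exact neg_ne_zero.2 (mul_ne_zero hl (pow_ne_zero _ ih))
  have hx : ∀ n, |l * B n 1 0| ≤ r ^ (n + 1) := by
    intro n
    induction n with
    | zero => rw [zero_add, pow_one]; exact hr.symm.le
    | succ n ih =>
      have e : l * B (n + 1) 1 0 = -(l * B n 1 0) ^ 2 := by rw [h10]; ring
      rw [e, abs_neg, abs_pow]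
      calc |l * B n 1 0| ^ 2 ≤ (r ^ (n + 1)) ^ 2 := by gcongr
        _ = r ^ (2 * n + 2) := by ring
        _ ≤ r ^ (n + 1 + 1) := pow_le_pow_of_le_one hr0 hlt.le (by omega)
  have hx1 : ∀ n, |l * B n 1 0| ≤ r := fun n =>
    (hx n).trans (by simpa using pow_le_pow_of_le_one hr0 hlt.le (Nat.le_add_left 1 n))
  -- 1/(1 − r) is the fixed point of x ↦ 1 + rx, which bounds the growth of the upper left entries.
  obtain ⟨M, hM0, hM1⟩ : ∃ M, |A 0 0| ≤ M ∧ 1 + r * M ≤ M := by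
    refine ⟨max |A 0 0| (1 / (1 - r)), le_max_left _ _, ?_⟩
    have h := le_max_right |A 0 0| (1 / (1 - r))
    rw [div_le_iff₀ (by linarith)] at h
    linarith
  have ha : ∀ n, |B n 0 0| ≤ M := by
    intro n
    induction n with
    | zero => exact hM0
    | succ n ih =>
      rw [h00]
      calc |1 - l * (B n 0 0 * B n 1 0)| ≤ |1| + |l * (B n 0 0 * B n 1 0)| := abs_sub _ _
        _ = 1 + |l * B n 1 0| * |B n 0 0| := by
          rw [abs_one, ← abs_mul]; congr 2; ring
        _ ≤ 1 + r * M := by gcongr; exact hx1 n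
        _ ≤ M := hM1
  have hxlim : Tendsto (fun n => l * B n 1 0) atTop (𝓝 0) :=
    squeeze_zero_norm hx
      ((tendsto_pow_atTop_nhds_zero_of_lt_one hr0 hlt).comp (tendsto_add_atTop_nat 1))
  have hclim : Tendsto (fun n => B n 1 0) atTop (𝓝 0) := by
    have := hxlim.const_mul l⁻¹
    simpa [inv_mul_cancel_left₀ hl] using this
  have haxlim : Tendsto (fun n => l * (B n 0 0 * B n 1 0)) atTop (𝓝 0) := by
    refine squeeze_zero_norm (a := fun n => M * |l * B n 1 0|) (fun n => ?_) ?_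
    · rw [Real.norm_eq_abs, mul_left_comm, abs_mul]
      gcongr
      exact ha n
    · simpa using hxlim.abs.const_mul M
  have ha1 : Tendsto (fun n => B (n + 1) 0 0) atTop (𝓝 1) := by
    simpa [h00] using haxlim.const_sub 1
  have ha0 : Tendsto (fun n => B n 0 0) atTop (𝓝 1) := (tendsto_add_atTop_iff_nat 1).1 ha1
  have hb1 : Tendsto (fun n => B (n + 1) 0 1) atTop (𝓝 l) := by
    simpa [h01] using (ha0.pow 2).const_mul l
  have hc1 : Tendsto (fun n => B (n + 1) 1 0) atTop (𝓝 0) := (tendsto_add_atTop_iff_nat 1).2 hclim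
  have hd1 : Tendsto (fun n => B (n + 1) 1 1) atTop (𝓝 1) := by
    simpa [h11] using haxlim.const_add 1
  -- Discreteness forces the sequence to reach T, yet its lower left entries never vanish.
  have hlim : Tendsto (fun n => (⟨B (n + 1), hmem _⟩ : G)) atTop (𝓝 ⟨heckeT l, hT⟩) := by
    rw [tendsto_subtype_rng]
    refine Matrix.SpecialLinearGroup.isClosedEmbedding_val.isEmbedding.tendsto_nhds_iff.2 ?_
    refine tendsto_pi_nhds.2 fun i => tendsto_pi_nhds.2 fun j => ?_
    fin_cases i <;> fin_cases j
    · exact ha1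
    · exact hb1
    · exact hc1
    · exact hd1
  rw [nhds_discrete, tendsto_pure] at hlim
  obtain ⟨n, hn⟩ := hlim.exists
  apply hne (n + 1)
  rw [Subtype.ext_iff] at hn
  change B (n + 1) = heckeT l at hn
  rw [hn]
  simp [coe_heckeT]

/-! ### Necessity for l < 2, and the theorem. -/

/-- Either `θ` is an integral fraction of `p`, or `θ` and `p` generate a number in `(0, θ / 2]`. -/
theorem exists_eq_nat_mul_or_exists_combination_le_half {θ p : ℝ} (hθ : 0 < θ) (hp : 0 < p) :
    (∃ n : ℕ, p = n * θ) ∨ ∃ k m : ℤ, 0 < k * θ + m * p ∧ k * θ + m * p ≤ θ / 2 := by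
  have hmem : ∀ x ∈ AddSubgroup.closure {θ, p}, ∃ k m : ℤ, k * θ + m * p = x := by
    intro x hx
    simpa [AddSubgroup.mem_closure_pair] using hx
  rcases AddSubgroup.dense_or_cyclic (AddSubgroup.closure {θ, p}) with h | ⟨a, ha⟩
  · right
    obtain ⟨x, hx, hx1, hx2⟩ := h.exists_between (half_pos hθ)
    obtain ⟨k, m, rfl⟩ := hmem x hx
    exact ⟨k, m, hx1, hx2.le⟩
  · obtain ⟨g, hg0, hg⟩ : ∃ g, 0 ≤ g ∧ AddSubgroup.closure {θ, p} = AddSubgroup.zmultiples g := by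
      rw [← AddSubgroup.zmultiples_eq_closure] at ha
      rcases le_total 0 a with h | h
      · exact ⟨a, h, ha⟩
      · exact ⟨-a, neg_nonneg.2 h, by rw [ha, AddSubgroup.zmultiples_neg]⟩
    have hθm : θ ∈ AddSubgroup.zmultiples g := hg ▸ AddSubgroup.subset_closure (by simp)
    have hpm : p ∈ AddSubgroup.zmultiples g := hg ▸ AddSubgroup.subset_closure (by simp)
    obtain ⟨u, hu⟩ := AddSubgroup.mem_zmultiples_iff.1 hθm
    obtain ⟨v, hv⟩ := AddSubgroup.mem_zmultiples_iff.1 hpm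
    rw [zsmul_eq_mul] at hu hv
    have hg1 : 0 < g := hg0.lt_of_ne (by rintro rfl; simp at hu; linarith)
    have hu0 : 0 < u := by
      have : (0 : ℝ) < u := pos_of_mul_pos_left (hu ▸ hθ) hg0
      exact_mod_cast this
    have hv0 : 0 < v := by
      have : (0 : ℝ) < v := pos_of_mul_pos_left (hv ▸ hp) hg0
      exact_mod_cast this
    -- Either θ is itself the generator g, or θ = ug with u ≥ 2 and so g ≤ θ/2.
    rcases eq_or_ne u 1 with rfl | hu1
    · left
      lift v to ℕ using hv0.le
      refine ⟨v, ?_⟩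
      rw [Int.cast_one, one_mul] at hu
      rw [← hv, hu]
      simp
    · right
      obtain ⟨k, m, hkm⟩ := hmem g (hg ▸ AddSubgroup.mem_zmultiples g)
      refine ⟨k, m, hkm ▸ hg1, ?_⟩
      rw [hkm, ← hu]
      have : (2 : ℝ) ≤ u := by exact_mod_cast (by omega : (2 : ℤ) ≤ u)
      nlinarith

theorem exists_eq_cos_of_discreteTopology {l : ℝ} (hl : 0 < l) (hl2 : l < 2)
    [DiscreteTopology (heckeGroup l)] :
    ∃ n : ℕ, 3 ≤ n ∧ l = 2 * Real.cos (Real.pi / (n : ℝ)) := by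
  obtain ⟨θ, hθ0, hθ2, rfl⟩ : ∃ θ, 0 < θ ∧ θ < Real.pi / 2 ∧ l = 2 * Real.cos θ :=
    ⟨Real.arccos (l / 2), Real.arccos_pos.2 (by linarith),
      Real.arccos_lt_pi_div_two.2 (by linarith),
      by rw [Real.cos_arccos (by linarith) (by linarith)]; ring⟩
  have hpi := Real.pi_pos
  have hsin : 0 < Real.sin θ := Real.sin_pos_of_pos_of_lt_pi hθ0 (by linarith)
  rcases exists_eq_nat_mul_or_exists_combination_le_half hθ0 hpi with ⟨n, hn⟩ | ⟨k, m, h0, h1⟩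
  · refine ⟨n, ?_, ?_⟩
    · have : (2 : ℝ) < n := by
        by_contra! h
        nlinarith
      exact_mod_cast this
    · have hn0 : (n : ℝ) ≠ 0 := by
        rintro h
        rw [h, zero_mul] at hn
        exact hpi.ne' hn
      rw [hn, mul_div_cancel_left₀ _ hn0]
  · exfalso
    set g := k * θ + m * Real.pi with hg
    have hsg : 0 < Real.sin g := Real.sin_pos_of_pos_of_lt_pi h0 (by linarith)
    have habs : |Real.sin (k * θ)| = Real.sin g := by
      rw [← abs_of_pos hsg, hg, Real.sin_add_int_mul_pi, abs_mul, abs_zpow, abs_neg, abs_one,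
        one_zpow, one_mul]
    have hentry : (heckeU (2 * Real.cos θ) ^ k) 1 0 = Real.sin (k * θ) / Real.sin θ := by
      rw [(isChebyshevSeq_sin hsin.ne').coe_heckeU_zpow]
      rfl
    -- l|c| = 2cos θ sin g / sin θ ≤ cos θ / cos(θ/2) < 1, using g ≤ θ/2 and the double angle
    -- formula.
    have hzero := lower_left_eq_zero_of_discreteTopology hl.ne' (heckeT_mem _)
      (Subgroup.zpow_mem _ (heckeU_mem (2 * Real.cos θ)) k) (by
        rw [hentry, abs_mul, abs_div, habs, abs_of_pos hl, abs_of_pos hsin, ← mul_div_assoc,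
          div_lt_one hsin]
        have hle : Real.sin g ≤ Real.sin (θ / 2) :=
          Real.sin_le_sin_of_le_of_le_pi_div_two (by linarith) (by linarith) h1
        have hhalf : 0 < Real.sin (θ / 2) := hsg.trans_le hle
        have hcos : Real.cos θ < Real.cos (θ / 2) :=
          Real.cos_lt_cos_of_nonneg_of_le_pi (by linarith) (by linarith) (by linarith)
        have hdouble : Real.sin θ = 2 * Real.sin (θ / 2) * Real.cos (θ / 2) := by
          rw [← Real.sin_two_mul]; congr 1; ring
        rw [hdouble]
        nlinarith)
    rw [hentry, div_eq_zero_iff] at hzero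
    rcases hzero with h | h
    · rw [h, abs_zero] at habs
      exact hsg.ne habs
    · exact hsin.ne' h

theorem theorem1p1 (l : ℝ) (hl : 0 < l) :
    DiscreteTopology (heckeGroup l) ↔
      l ∈ Set.Ici (2 : ℝ) ∪ {x : ℝ | ∃ n : ℕ, 3 ≤ n ∧ x = 2 * Real.cos (Real.pi / (n : ℝ))} := by
  constructor
  · intro h
    rcases le_or_gt 2 l with h2 | h2
    · exact Or.inl h2
    · exact Or.inr (exists_eq_cos_of_discreteTopology hl h2)
  · rintro (h | ⟨n, hn, rfl⟩)
    · have hs := isChebyshevSeq_S l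
      exact discreteTopology_of_entries fun g hg =>
        heckeGroup_entry_eq_zero_or hs (hs.hasGaps h) hg
    · have hsin : Real.sin (Real.pi / n) ≠ 0 := by
        have hn' : (3 : ℝ) ≤ n := by exact_mod_cast hn
        exact (Real.sin_pos_of_pos_of_lt_pi (by positivity)
          (div_lt_self Real.pi_pos (by linarith))).ne'
      exact discreteTopology_of_entries fun g hg =>
        heckeGroup_entry_eq_zero_or (isChebyshevSeq_sin hsin) (hasGaps_sin (by omega)) hg
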